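/- Let $\langle y\rangle=(1+|y|^2)^{1/2}$ and $$X=\{f\in C^2(\mathbb R;\mathbb R)\;:\;\langle\cdot\rangle^{1/2}f\in L^\infty(\mathbb R),\ \langle\cdot\rangle^{-1/2}f'\in L^\infty(\mathbb R)\}.$$ There is $\varepsilon_0>0$ such that for every $A_0$ with $0<A_0<\varepsilon_0$ there is exactly one function $A\in X$ that satisfies $$A''(y)+\frac{y^2}{16}A(y)=\frac y4A(y)^3-\frac3{16}A(y)^5\qquad\text{for all }y\in\mathbb R,$$ $A(0)=A_0$ and $A'(0)=0$. Moreover, for this $A$ there are real constants $Q_+,Q_-,\omega_{+,0},\omega_{-,0}$ (which may depend on $A_0$) such that $$A(y)=Q_+|y|^{-1/2}\cos\Big(\omega_{+,0}-\frac{y^2}8+\frac3{16}Q_+^2\log\frac{y^2}8\Big)+O(y^{-1})\qquad(y\to+\infty),$$ $$A(y)=Q_-|y|^{-1/2}\cos\Big(\omega_{-,0}-\frac{y^2}8-\frac3{16}Q_-^2\log\frac{y^2}8\Big)+O(y^{-1})\qquad(y\to-\infty).$$ -/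

import Mathlib

open Filter Asymptotics MeasureTheory
open scoped ENNReal

noncomputable section

/-- The Japanese bracket `⟨y⟩ = (1 + |y|²)^{1/2}` on the real line. -/
def japaneseBracket (y : ℝ) : ℝ := (1 + |y| ^ 2) ^ (1 / 2 : ℝ)

/-- The function space `X`: real valued `f ∈ C²(ℝ)` such that `⟨·⟩^{1/2} f` and
`⟨·⟩^{-1/2} f'` belong to `L^∞(ℝ)`. -/
def profileSpace : Set (ℝ → ℝ) :=
  {f | ContDiff ℝ 2 f ∧
    MemLp (fun y : ℝ => japaneseBracket y ^ (1 / 2 : ℝ) * f y) ∞ volume ∧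
    MemLp (fun y : ℝ => japaneseBracket y ^ (-(1 / 2) : ℝ) * deriv f y) ∞ volume}

/-- `A` lies in the space `X`, solves the amplitude equation
`A'' + (y²/16) A = (y/4) A³ - (3/16) A⁵` on all of `ℝ`, and has the initial data
`A(0) = A₀`, `A'(0) = 0`. -/
structure IsProfileSolution (A₀ : ℝ) (A : ℝ → ℝ) : Prop where
  mem : A ∈ profileSpace
  ode : ∀ y : ℝ,
    deriv (deriv A) y + y ^ 2 / 16 * A y = y / 4 * A y ^ 3 - 3 / 16 * A y ^ 5
  init : A 0 = A₀
  init_deriv : deriv A 0 = 0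

end

/-! Write `k = ⟨y⟩⁻¹`. For large `|y|` the linear part oscillates with phase `y²/8`, `A` of size
`|y|^{-1/2}` and `A'` of size `|y|^{1/2}`; `profileSize` is the square of this norm. A weighted
energy with two lower-order corrections is equivalent to `profileSize` for small solutions
(`profileSize_le_profileEnergy`) and changes only at relative rate `O(k³)`
(`abs_profileEnergyDeriv_le`). Since `k³` is integrable, Grönwall and a continuity argument keep
small data small on the whole line, which gives global existence and membership in `X`. Uniqueness
is that of a `C¹` vector field.

For the asymptotics at `+∞`, `u = √y A` obeys an oscillator of frequency `y/4` with forcing `σ u³ /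
y + O(y⁻³)`; the quintic term falls into the error. With `z = u + i v`, a change of variables of
size `y⁻²` removes every cubic monomial except the resonant `|z|² z`
(`exists_oscillator_asymptotics`). What remains rotates `z` at speed proportional to `|z|² / y`: the
modulus converges, and integrating `1 / y` gives the logarithmic phase (`exists_amplitude_phase`).
Reflection `y ↦ -y` only flips the sign of the cubic term, so `σ = -1` treats `-∞`. -/

open Set Metric
open scoped NNReal Topology

/-! ### Continuation and uniqueness for autonomous equations -/

/-- Continuity argument: a continuous function which cannot enter `(R, R')` before exceeding `R'`
stays below `R`. -/
theorem le_of_bootstrap {φ : ℝ → ℝ} {T R R' : ℝ} (hR : R < R') (hφ : ContinuousOn φ (Icc 0 T))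
    (h0 : φ 0 ≤ R)
    (h : ∀ t ∈ Icc 0 T, (∀ s ∈ Ico 0 t, φ s ≤ R') → ∀ s ∈ Ico 0 t, φ s ≤ R) :
    ∀ s ∈ Ico 0 T, φ s ≤ R := by
  intro s₀ hs₀
  have hT : 0 ≤ T := hs₀.1.trans hs₀.2.le
  have hclosed : IsClosed (Icc 0 T ∩ φ ⁻¹' Ici R') :=
    hφ.preimage_isClosed_of_isClosed isClosed_Icc isClosed_Ici
  rcases (Icc 0 T ∩ φ ⁻¹' Ici R').eq_empty_or_nonempty with he | hne
  · refine h T ⟨hT, le_rfl⟩ (fun s hs => ?_) s₀ hs₀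
    by_contra! hlt
    have : s ∈ Icc 0 T ∩ φ ⁻¹' Ici R' := ⟨⟨hs.1, hs.2.le⟩, hlt.le⟩
    simp [he] at this
  · exfalso
    have hbdd : BddBelow (Icc 0 T ∩ φ ⁻¹' Ici R') := ⟨0, fun x hx => hx.1.1⟩
    obtain ⟨hmem, hge⟩ := hclosed.csInf_mem hne hbdd
    -- At the first time `t` with `φ ≥ R'`, the implication applies on `[0, t)`, so continuity gives
    -- `φ t ≤ R < R'`.
    set t := sInf (Icc 0 T ∩ φ ⁻¹' Ici R') with ht
    have hge : R' ≤ φ t := hge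
    have htpos : 0 < t := by
      rcases hmem.1.eq_or_lt with h' | h'
      · rw [← h'] at hge; linarith
      · exact h'
    have hle : ∀ s ∈ Ico 0 t, φ s ≤ R := by
      refine h t hmem fun s hs => ?_
      by_contra! hlt
      exact absurd (csInf_le hbdd ⟨⟨hs.1, hs.2.le.trans hmem.2⟩, hlt.le⟩) (not_le.mpr hs.2)
    have hcl : t ∈ closure (Ico 0 t) := by
      rw [closure_Ico htpos.ne]; exact ⟨htpos.le, le_rfl⟩
    have : φ t ≤ R := by
      refine ContinuousWithinAt.closure_le hcl
        ((hφ t hmem).mono fun s hs => ⟨hs.1, hs.2.le.trans hmem.2⟩)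
        (continuousWithinAt_const (b := R)) hle
    linarith

/-- A bounded globally Lipschitz autonomous vector field has solutions on every interval. -/
theorem exists_hasDerivAt_Ioo_of_lipschitzWith {E : Type*} [NormedAddCommGroup E]
    [NormedSpace ℝ E] [CompleteSpace E] {f : E → E} {K : ℝ≥0} (hf : LipschitzWith K f) {L : ℝ≥0}
    (hb : ∀ x, ‖f x‖ ≤ L) (x₀ : E) {T : ℝ} (hT : 0 ≤ T) :
    ∃ γ : ℝ → E, γ 0 = x₀ ∧ ContinuousOn γ (Icc (-T) T) ∧
      ∀ t ∈ Ioo (-T) T, HasDerivAt γ (f (γ t)) t := by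
  have h0 : (0 : ℝ) ∈ Icc (-T) T := ⟨by linarith, hT⟩
  have hpl : IsPicardLindelof (fun _ => f) (⟨0, h0⟩ : Icc (-T) T) x₀ (L * T.toNNReal) 0 L K := by
    refine .of_time_independent (fun x _ => hb x) hf.lipschitzOnWith ?_
    simp [hT]
  obtain ⟨γ, h1, h2⟩ := hpl.exists_eq_forall_mem_Icc_hasDerivWithinAt₀
  exact ⟨γ, h1, HasDerivWithinAt.continuousOn h2, fun t ht =>
    (h2 t ⟨ht.1.le, ht.2.le⟩).hasDerivAt (Icc_mem_nhds ht.1 ht.2)⟩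

/-- A priori bounds imply existence on bounded intervals. -/
theorem exists_hasDerivAt_Ioo_of_bound {E : Type*} [NormedAddCommGroup E] [NormedSpace ℝ E]
    [FiniteDimensional ℝ E] {f : E → E} (hf : ContDiff ℝ 1 f) (x₀ : E) {T R : ℝ} (hT : 0 ≤ T)
    (hx₀ : ‖x₀‖ ≤ R)
    (h : ∀ γ : ℝ → E, ∀ t ≤ T, γ 0 = x₀ → (∀ s ∈ Ioo (-t) t, HasDerivAt γ (f (γ s)) s) →
      ∀ s ∈ Ioo (-t) t, ‖γ s‖ ≤ R) :
    ∃ γ : ℝ → E, γ 0 = x₀ ∧ ∀ t ∈ Ioo (-T) T, HasDerivAt γ (f (γ t)) t := by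
  have : CompleteSpace E := FiniteDimensional.complete ℝ E
  have hR : 0 ≤ R := (norm_nonneg _).trans hx₀
  -- The truncated field is bounded and Lipschitz, and agrees with `f` on the ball of radius `R +
  -- 1`. The a priori bound `R` then prevents its solution from ever noticing the truncation.
  let χ : ContDiffBump (0 : E) := ⟨R + 1, R + 2, by linarith, by linarith⟩
  have hsupp : HasCompactSupport fun x => χ x • f x := χ.hasCompactSupport.smul_right
  have hsmooth : ContDiff ℝ 1 fun x => χ x • f x := χ.contDiff.smul hf
  obtain ⟨K, hK⟩ := hsmooth.lipschitzWith_of_hasCompactSupport hsupp one_ne_zero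
  obtain ⟨L, hL⟩ := hsupp.exists_bound_of_continuous hsmooth.continuous
  have hL0 : 0 ≤ L := (norm_nonneg _).trans (hL 0)
  obtain ⟨γ, hγ0, hγc, hγ⟩ := exists_hasDerivAt_Ioo_of_lipschitzWith hK (L := .mk L hL0) hL x₀ hT
  have hbound : ∀ s ∈ Ico 0 T, max ‖γ s‖ ‖γ (-s)‖ ≤ R := by
    refine le_of_bootstrap (φ := fun s => max ‖γ s‖ ‖γ (-s)‖) (R' := R + 1) (by linarith) ?_
      (by simpa [hγ0] using hx₀) ?_
    · refine ContinuousOn.sup (hγc.mono fun s hs => ⟨by linarith [hs.1], hs.2⟩).norm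
        (hγc.comp continuous_neg.continuousOn fun s hs => ?_).norm
      exact ⟨by linarith [hs.2], by linarith [hs.1]⟩
    · intro t ht hbd
      have hbd' : ∀ s ∈ Ioo (-t) t, ‖γ s‖ ≤ R + 1 := by
        intro s hs
        rcases le_total 0 s with h0 | h0
        · exact (le_max_left _ _).trans (hbd s ⟨h0, hs.2⟩)
        · have := (le_max_right _ _).trans (hbd (-s) ⟨by linarith, by linarith [hs.1]⟩)
          simpa using this
      have key := h γ t ht.2 hγ0 fun s hs => by
        have h1 := hγ s ⟨by linarith [hs.1, ht.2], by linarith [hs.2, ht.2]⟩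
        rwa [χ.one_of_mem_closedBall (by simpa using hbd' s hs), one_smul] at h1
      intro s hs
      exact max_le (key s ⟨by linarith [hs.1, hs.2], hs.2⟩)
        (key (-s) ⟨by linarith [hs.2], by linarith [hs.1, hs.2]⟩)
  refine ⟨γ, hγ0, fun s hs => ?_⟩
  have hs' : ‖γ s‖ ≤ R := by
    rcases le_total 0 s with h0 | h0
    · exact (le_max_left _ _).trans (hbound s ⟨h0, hs.2⟩)
    · have := (le_max_right _ _).trans (hbound (-s) ⟨by linarith, by linarith [hs.1]⟩)
      simpa using this
  have h1 := hγ s hs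
  have hmem : γ s ∈ closedBall (0 : E) χ.rIn := by
    simp only [mem_closedBall, dist_zero_right]
    exact hs'.trans (by change R ≤ R + 1; linarith)
  rwa [χ.one_of_mem_closedBall hmem, one_smul] at h1

theorem contMDiff_section_of_contDiff {E : Type*} [NormedAddCommGroup E] [NormedSpace ℝ E]
    {f : E → E} (hf : ContDiff ℝ 1 f) :
    ContMDiff (modelWithCornersSelf ℝ E) (modelWithCornersSelf ℝ E).tangent 1
      (fun x ↦ (⟨x, f x⟩ : TangentBundle (modelWithCornersSelf ℝ E) E)) := by
  exact contMDiff_vectorSpace_iff_contDiff.mpr hf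

/-- A priori bounds imply global existence. -/
theorem exists_forall_hasDerivAt_of_bound {E : Type*} [NormedAddCommGroup E] [NormedSpace ℝ E]
    [FiniteDimensional ℝ E] {f : E → E} (hf : ContDiff ℝ 1 f) (x₀ : E)
    (h : ∀ T : ℝ, ∃ R : ℝ, ‖x₀‖ ≤ R ∧ ∀ γ : ℝ → E, ∀ t ≤ T, γ 0 = x₀ →
      (∀ s ∈ Ioo (-t) t, HasDerivAt γ (f (γ s)) s) → ∀ s ∈ Ioo (-t) t, ‖γ s‖ ≤ R) :
    ∃ γ : ℝ → E, γ 0 = x₀ ∧ ∀ t, HasDerivAt γ (f (γ t)) t := by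
  have : CompleteSpace E := FiniteDimensional.complete ℝ E
  obtain ⟨γ, h0, hγ⟩ := (exists_isMIntegralCurve_iff_exists_isMIntegralCurveOn_Ioo
    (I := modelWithCornersSelf ℝ E) (v := f) (contMDiff_section_of_contDiff hf) x₀).mpr fun a => by
      obtain ⟨R, hR, hb⟩ := h |a|
      obtain ⟨γ, h0, hγ⟩ := exists_hasDerivAt_Ioo_of_bound hf x₀ (abs_nonneg a) hR hb
      refine ⟨γ, h0, fun t ht => HasFDerivWithinAt.hasMFDerivWithinAt ?_⟩
      have ha := le_abs_self a
      exact (hγ t ⟨by linarith [ht.1], by linarith [ht.2]⟩).hasDerivWithinAt.hasFDerivWithinAt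
  exact ⟨γ, h0, fun t => hasDerivAt_iff_hasFDerivAt.mpr (hγ t).hasFDerivAt⟩

theorem eq_of_forall_hasDerivAt {E : Type*} [NormedAddCommGroup E] [NormedSpace ℝ E]
    [CompleteSpace E] {f : E → E} (hf : ContDiff ℝ 1 f) {γ γ' : ℝ → E} {t₀ : ℝ}
    (h : ∀ t, HasDerivAt γ (f (γ t)) t) (h' : ∀ t, HasDerivAt γ' (f (γ' t)) t)
    (h0 : γ t₀ = γ' t₀) : γ = γ' :=
  isMIntegralCurve_Ioo_eq_of_contMDiff_boundaryless (I := modelWithCornersSelf ℝ E) (v := f)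
    (contMDiff_section_of_contDiff hf) (fun t => (h t).hasFDerivAt.hasMFDerivAt)
    (fun t => (h' t).hasFDerivAt.hasMFDerivAt) h0

/-! ### The weight and the almost conserved energy -/

/-- The weight `⟨y⟩⁻¹`. -/
noncomputable def bracketInv (y : ℝ) : ℝ := (√(1 + y ^ 2))⁻¹

theorem bracketInv_pos (y : ℝ) : 0 < bracketInv y := by
  unfold bracketInv; positivity

theorem bracketInv_sq (y : ℝ) : bracketInv y ^ 2 * (1 + y ^ 2) = 1 := by
  unfold bracketInv
  rw [inv_pow, Real.sq_sqrt (by positivity)]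
  exact inv_mul_cancel₀ (by positivity)

theorem bracketInv_zero : bracketInv 0 = 1 := by simp [bracketInv]

theorem bracketInv_le_one (y : ℝ) : bracketInv y ≤ 1 := by
  nlinarith [bracketInv_sq y, bracketInv_pos y, sq_nonneg (bracketInv y * y)]

theorem abs_mul_bracketInv_le_one (y : ℝ) : |y| * bracketInv y ≤ 1 := by
  have h := bracketInv_sq y
  have h1 := bracketInv_pos y
  have h2 := abs_nonneg y
  have h3 := sq_abs y
  nlinarith [mul_nonneg h2 h1.le]

theorem hasDerivAt_bracketInv (y : ℝ) :
    HasDerivAt bracketInv (-(y * bracketInv y ^ 3)) y := by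
  have hpos : (0 : ℝ) < 1 + y ^ 2 := by positivity
  have h1 : HasDerivAt (fun x : ℝ => 1 + x ^ 2) (2 * y) y := by
    simpa using (hasDerivAt_pow 2 y).const_add 1
  have h2 := (h1.sqrt hpos.ne').inv (Real.sqrt_pos.mpr hpos).ne'
  refine h2.congr_deriv ?_
  have h3 := Real.sqrt_pos.mpr hpos
  unfold bracketInv
  field_simp

/-- The weight `k³` has an explicit primitive bounded by `1` in absolute value; this is the
integrability used in Grönwall's inequality. -/
theorem hasDerivAt_mul_bracketInv (y : ℝ) :
    HasDerivAt (fun x => x * bracketInv x) (bracketInv y ^ 3) y := by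
  refine ((hasDerivAt_id y).mul (hasDerivAt_bracketInv y)).congr_deriv ?_
  simp only [id_eq]
  linear_combination (-bracketInv y) * bracketInv_sq y

/-- The size `⟨y⟩ a² + ⟨y⟩⁻¹ d²` of a pair of values of a profile and its derivative. -/
noncomputable def profileSize (y a d : ℝ) : ℝ := bracketInv y * ((1 + y ^ 2) * a ^ 2 + d ^ 2)

/-- The almost conserved energy of the amplitude equation. -/
noncomputable def profileEnergy (y a d : ℝ) : ℝ :=
  bracketInv y * d ^ 2 / 2 + y * bracketInv y ^ 3 * (a * d) / 2 +
    (y ^ 2 * bracketInv y / 16 + bracketInv y ^ 3) * a ^ 2 / 2 - y * bracketInv y * a ^ 4 / 16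

/-- The time derivative of `profileEnergy` along solutions. -/
noncomputable def profileEnergyDeriv (y a d : ℝ) : ℝ :=
  3 / 2 * bracketInv y ^ 5 * (a * d) +
    (y * bracketInv y ^ 3 / 16 - 3 / 2 * y * bracketInv y ^ 5) * a ^ 2 +
    (y ^ 2 * bracketInv y ^ 3 / 8 - bracketInv y ^ 3 / 16) * a ^ 4 -
    3 / 16 * bracketInv y * (a ^ 5 * d) - 3 / 32 * y * bracketInv y ^ 3 * a ^ 6

theorem profileSize_nonneg (y a d : ℝ) : 0 ≤ profileSize y a d := by
  have := bracketInv_pos y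
  unfold profileSize; positivity

theorem sq_le_bracketInv_mul_profileSize (y a d : ℝ) :
    a ^ 2 ≤ bracketInv y * profileSize y a d := by
  unfold profileSize
  nlinarith [bracketInv_sq y, sq_nonneg (bracketInv y * d)]

theorem bracketInv_mul_sq_le_profileSize (y a d : ℝ) :
    bracketInv y * d ^ 2 ≤ profileSize y a d := by
  have := bracketInv_pos y
  unfold profileSize
  have : 0 ≤ bracketInv y * ((1 + y ^ 2) * a ^ 2) := by positivity
  nlinarith

theorem abs_mul_le_profileSize (y a d : ℝ) : |a * d| ≤ profileSize y a d / 2 := by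
  have hk := bracketInv_pos y
  have hk2 := bracketInv_sq y
  set k := bracketInv y with hkdef
  have key : profileSize y a d * k = a ^ 2 + (k * d) ^ 2 := by
    simp only [profileSize, ← hkdef]
    linear_combination a ^ 2 * hk2
  rw [abs_le]
  constructor
  · nlinarith [sq_nonneg (a + k * d)]
  · nlinarith [sq_nonneg (a - k * d)]

/-- Each monomial is estimated by `a² ≤ k S`, `|a d| ≤ S / 2` and `|y| k ≤ 1`, where `S` is the
size; the hypothesis `S ≤ 1` reduces higher powers of `S` to the first. -/
theorem abs_profileEnergyDeriv_le {y a d : ℝ} (hS : profileSize y a d ≤ 1) :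
    |profileEnergyDeriv y a d| ≤ 3 * bracketInv y ^ 3 * profileSize y a d := by
  have hk := bracketInv_pos y
  have hk1 := bracketInv_le_one y
  have hy := abs_mul_bracketInv_le_one y
  have hS0 := profileSize_nonneg y a d
  have ha := sq_le_bracketInv_mul_profileSize y a d
  have had := abs_mul_le_profileSize y a d
  unfold profileEnergyDeriv
  set k := bracketInv y
  set S := profileSize y a d
  have hk3 : 0 < k ^ 3 := by positivity
  have hk2 : k ^ 2 ≤ 1 := pow_le_one₀ hk.le hk1
  have hak : a ^ 2 ≤ k := ha.trans (by nlinarith)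
  have ha4 : a ^ 4 ≤ k ^ 2 * S := by
    calc a ^ 4 = a ^ 2 * a ^ 2 := by ring
      _ ≤ k * (k * S) := by gcongr
      _ = k ^ 2 * S := by ring
  have ha4' : a ^ 4 ≤ k ^ 2 := ha4.trans (by nlinarith [sq_nonneg k])
  have ha6 : a ^ 6 ≤ k ^ 3 * S := by
    calc a ^ 6 = a ^ 2 * a ^ 4 := by ring
      _ ≤ k * (k ^ 2 * S) := by gcongr
      _ = k ^ 3 * S := by ring
  have e1 : |3 / 2 * k ^ 5 * (a * d)| ≤ 3 / 4 * (k ^ 3 * S) := by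
    rw [abs_mul, abs_of_pos (by positivity)]
    calc 3 / 2 * k ^ 5 * |a * d| ≤ 3 / 2 * (k ^ 3 * 1) * (S / 2) := by
          have : k ^ 5 = k ^ 3 * k ^ 2 := by ring
          rw [this]; gcongr
      _ = _ := by ring
  have e2 : |y * k ^ 3 / 16 * a ^ 2| ≤ 1 / 16 * (k ^ 3 * S) := by
    rw [abs_mul, abs_div, abs_mul, abs_of_pos hk3, abs_of_nonneg (sq_nonneg a),
      abs_of_pos (by norm_num : (0 : ℝ) < 16)]
    calc |y| * k ^ 3 / 16 * a ^ 2 = (|y| * k) * k ^ 2 / 16 * a ^ 2 := by ring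
      _ ≤ 1 * k ^ 2 / 16 * (k * S) := by gcongr
      _ = _ := by ring
  have e3 : |3 / 2 * y * k ^ 5 * a ^ 2| ≤ 3 / 2 * (k ^ 3 * S) := by
    rw [abs_mul, abs_mul, abs_mul, abs_of_pos (by positivity : 0 < k ^ 5),
      abs_of_nonneg (sq_nonneg a), abs_of_pos (by norm_num : (0 : ℝ) < 3 / 2)]
    calc 3 / 2 * |y| * k ^ 5 * a ^ 2 = 3 / 2 * (|y| * k) * (k ^ 2 * k ^ 2) * a ^ 2 := by ring
      _ ≤ 3 / 2 * 1 * (k ^ 2 * 1) * (k * S) := by gcongr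
      _ = _ := by ring
  have e4 : |y ^ 2 * k ^ 3 / 8 * a ^ 4| ≤ 1 / 8 * (k ^ 3 * S) := by
    rw [abs_of_nonneg (by positivity)]
    calc y ^ 2 * k ^ 3 / 8 * a ^ 4 = (|y| * k) ^ 2 * k / 8 * a ^ 4 := by
          rw [mul_pow, sq_abs]; ring
      _ ≤ 1 ^ 2 * k / 8 * (k ^ 2 * S) := by gcongr
      _ = _ := by ring
  have e5 : |k ^ 3 / 16 * a ^ 4| ≤ 1 / 16 * (k ^ 3 * S) := by
    rw [abs_of_nonneg (by positivity)]
    calc k ^ 3 / 16 * a ^ 4 ≤ k ^ 3 / 16 * (1 * S) := by gcongr; exact ha4.trans (by gcongr)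
      _ = _ := by ring
  have e6 : |3 / 16 * k * (a ^ 5 * d)| ≤ 3 / 32 * (k ^ 3 * S) := by
    have : 3 / 16 * k * (a ^ 5 * d) = 3 / 16 * k * a ^ 4 * (a * d) := by ring
    rw [this, abs_mul, abs_of_nonneg (by positivity)]
    calc 3 / 16 * k * a ^ 4 * |a * d| ≤ 3 / 16 * k * k ^ 2 * (S / 2) := by gcongr
      _ = _ := by ring
  have e7 : |3 / 32 * y * k ^ 3 * a ^ 6| ≤ 3 / 32 * (k ^ 3 * S) := by
    rw [abs_mul, abs_mul, abs_mul, abs_of_pos hk3, abs_of_nonneg (by positivity : 0 ≤ a ^ 6),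
      abs_of_pos (by norm_num : (0 : ℝ) < 3 / 32)]
    calc 3 / 32 * |y| * k ^ 3 * a ^ 6 = 3 / 32 * (|y| * k) * k ^ 2 * a ^ 6 := by ring
      _ ≤ 3 / 32 * 1 * 1 * (k ^ 3 * S) := by gcongr
      _ = _ := by ring
  have hKS : 0 ≤ k ^ 3 * S := by positivity
  rw [abs_le] at *
  constructor <;> nlinarith

/-- The quadratic part of the energy is positive definite because the cross term is absorbed by `d²`
and by the extra `k³ a²`; smallness of the size lets the quartic term be absorbed as well. -/
theorem profileSize_le_profileEnergy {y a d : ℝ} (hS : profileSize y a d ≤ 1 / 100) :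
    profileSize y a d ≤ 200 * profileEnergy y a d := by
  have hk := bracketInv_pos y
  have hk1 := bracketInv_le_one y
  have hk2 := bracketInv_sq y
  have hy := abs_mul_bracketInv_le_one y
  have ha := sq_le_bracketInv_mul_profileSize y a d
  set k := bracketInv y with hkdef
  have hak : a ^ 2 ≤ 1 / 100 := by
    have := profileSize_nonneg y a d
    nlinarith
  have hyk : y * a ^ 4 ≤ (1 + y ^ 2) / 2 * (a ^ 2 / 100) := by
    have h1 : y ≤ (1 + y ^ 2) / 2 := by nlinarith [sq_nonneg (y - 1)]
    calc y * a ^ 4 ≤ (1 + y ^ 2) / 2 * a ^ 4 := by gcongr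
      _ = (1 + y ^ 2) / 2 * (a ^ 2 * a ^ 2) := by ring
      _ ≤ (1 + y ^ 2) / 2 * (a ^ 2 * (1 / 100)) := by gcongr
      _ = _ := by ring
  -- The weight `99/100` uses exactly the `d²` left over: `200 / 2 - 1 = 99`, against `100` copies
  -- of the cross term.
  have hcross : -(y * k ^ 2 * (a * d)) ≤ 99 / 100 * d ^ 2 + k ^ 2 * a ^ 2 * (100 / 396) := by
    have hyk2 : y ^ 2 * k ^ 2 ≤ 1 := by nlinarith
    have h1 : (y * k ^ 2 * a) ^ 2 ≤ k ^ 2 * a ^ 2 := by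
      have : (y * k ^ 2 * a) ^ 2 = (y ^ 2 * k ^ 2) * (k ^ 2 * a ^ 2) := by ring
      rw [this]
      exact mul_le_of_le_one_left (by positivity) hyk2
    nlinarith [sq_nonneg (99 / 50 * d + y * k ^ 2 * a)]
  -- As `k² (1 + y²) = 1`, the arithmetic-geometric mean inequality for `k²` and `1 + y²` beats the
  -- negative constant.
  have hquad : 0 ≤ 1 / 40 * (1 + y ^ 2) - 7 / 200 + 73 / 200 * k ^ 2
      - (1 + y ^ 2) / 3200 := by
    have hY : 1 ≤ 1 + y ^ 2 := by nlinarith [sq_nonneg y]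
    nlinarith [sq_nonneg (k - 3 / 20 * (k * (1 + y ^ 2))), sq_nonneg y]
  have hmain : 0 ≤ 200 * (d ^ 2 / 2 + y * k ^ 2 * (a * d) / 2 +
      (y ^ 2 / 16 + k ^ 2) * a ^ 2 / 2 - y * a ^ 4 / 16) - ((1 + y ^ 2) * a ^ 2 + d ^ 2) := by
    nlinarith [mul_nonneg hquad (sq_nonneg a)]
  have := mul_nonneg hk.le hmain
  simp only [profileSize, profileEnergy, ← hkdef]
  nlinarith

/-- The corrections in the energy are tuned to this computation. The cross term cancels the `d²`
produced by `k' = -y k³` and reduces the `a²` terms from `y² k / 16` to order `y k³`; the term `k³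
a² / 2` cancels the `k³ a d` so created, and the quartic term cancels the main cubic work `y k a³ d
/ 4`. -/
theorem hasDerivAt_profileEnergy {A D : ℝ → ℝ} {y : ℝ} (hA : HasDerivAt A (D y) y)
    (hD : HasDerivAt D (-(y ^ 2 / 16 * A y) + (y / 4 * A y ^ 3 - 3 / 16 * A y ^ 5)) y) :
    HasDerivAt (fun x => profileEnergy x (A x) (D x)) (profileEnergyDeriv y (A y) (D y)) y := by
  have hk := hasDerivAt_bracketInv y
  have hid := hasDerivAt_id' y
  have h1 := (hk.mul (hD.pow 2)).div_const 2
  have h2 := ((hid.mul (hk.pow 3)).mul (hA.mul hD)).div_const 2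
  have h3 := (((((hid.pow 2).mul hk).div_const 16).add (hk.pow 3)).mul (hA.pow 2)).div_const 2
  have h4 := ((hid.mul hk).mul (hA.pow 4)).div_const 16
  refine (((h1.add h2).add h3).sub h4).congr_deriv ?_
  have hk2 := bracketInv_sq y
  simp only [profileEnergyDeriv, Pi.mul_apply, Pi.pow_apply, Pi.add_apply]
  set k := bracketInv y
  push_cast
  linear_combination (-(3 / 2) * k ^ 3 * (A y * D y) - y * k / 16 * A y ^ 2 + k / 16 * A y ^ 4) * hk2

theorem bracketInv_neg (y : ℝ) : bracketInv (-y) = bracketInv y := by simp [bracketInv]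

/-! ### Propagation of smallness -/

/-- Grönwall's inequality with the integrable weight `⟨y⟩⁻³`. -/
theorem le_exp_mul_of_abs_deriv_le {F F' : ℝ → ℝ} {b c : ℝ} (hb : 0 ≤ b) (hc : 0 ≤ c)
    (hF : ∀ x ∈ Icc 0 b, HasDerivAt F (F' x) x)
    (hF' : ∀ x ∈ Icc 0 b, |F' x| ≤ c * bracketInv x ^ 3 * F x) (h0 : 0 ≤ F 0) :
    F b ≤ Real.exp c * F 0 := by
  have hder : ∀ x ∈ Icc 0 b, HasDerivAt (fun x => Real.exp (-(c * (x * bracketInv x))) * F x)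
      (Real.exp (-(c * (x * bracketInv x))) * (F' x - c * bracketInv x ^ 3 * F x)) x := by
    intro x hx
    have h1 := ((hasDerivAt_mul_bracketInv x).const_mul c).neg.exp.mul (hF x hx)
    refine h1.congr_deriv ?_
    simp only [Pi.neg_apply]
    ring
  have hanti : AntitoneOn (fun x => Real.exp (-(c * (x * bracketInv x))) * F x) (Icc 0 b) := by
    refine antitoneOn_of_hasDerivWithinAt_nonpos (convex_Icc 0 b)
      (fun x hx => (hder x hx).continuousAt.continuousWithinAt)
      (fun x hx => (hder x (interior_subset hx)).hasDerivWithinAt) fun x hx => ?_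
    have := (abs_le.mp (hF' x (interior_subset hx))).2
    exact mul_nonpos_of_nonneg_of_nonpos (Real.exp_pos _).le (by linarith)
  have h1 := hanti (left_mem_Icc.mpr hb) (right_mem_Icc.mpr hb) hb
  simp only [zero_mul, mul_zero, neg_zero, Real.exp_zero, one_mul] at h1
  have h2 : F b = Real.exp (c * (b * bracketInv b)) *
      (Real.exp (-(c * (b * bracketInv b))) * F b) := by
    rw [← mul_assoc, ← Real.exp_add, add_neg_cancel, Real.exp_zero, one_mul]
  rw [h2]
  have h3 : b * bracketInv b ≤ 1 := by
    simpa [abs_of_nonneg hb] using abs_mul_bracketInv_le_one b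
  calc Real.exp (c * (b * bracketInv b)) * (Real.exp (-(c * (b * bracketInv b))) * F b)
      ≤ Real.exp (c * (b * bracketInv b)) * F 0 := by gcongr
    _ ≤ Real.exp c * F 0 := by gcongr; nlinarith

/-- The smallness threshold for the initial amplitude. -/
noncomputable def profileThreshold : ℝ := Real.exp (-300) / 1000

theorem profileThreshold_pos : 0 < profileThreshold := by unfold profileThreshold; positivity

/-- The Grönwall rate is `600 = 3 * 200`, from the derivative bound and coercivity. With initial
energy `A₀² / 2`, the size is at most `200 * exp 600 * A₀² / 2`, and the factor `exp (-300)` in the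
threshold offsets this loss. -/
theorem exp_mul_sq_le_of_abs_lt {A₀ : ℝ} (h : |A₀| < profileThreshold) :
    Real.exp 600 * (100 * A₀ ^ 2) ≤ 1 / 200 := by
  have h1 : A₀ ^ 2 ≤ profileThreshold ^ 2 := by
    rw [← sq_abs]; exact pow_le_pow_left₀ (abs_nonneg _) h.le 2
  have h2 : Real.exp 600 * profileThreshold ^ 2 = 1 / 1000000 := by
    have h3 : Real.exp 600 * Real.exp (-300) ^ 2 = 1 := by
      rw [← Real.exp_nat_mul, ← Real.exp_add]; norm_num
    unfold profileThreshold
    linear_combination (1 / 1000000) * h3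
  nlinarith [Real.exp_pos 600]

/-- Small solutions of the amplitude equation stay small. -/
theorem profileSize_le_of_hasDerivAt {A D : ℝ → ℝ} {T : ℝ}
    (hA : ∀ y ∈ Ioo (-T) T, HasDerivAt A (D y) y)
    (hD : ∀ y ∈ Ioo (-T) T,
      HasDerivAt D (-(y ^ 2 / 16 * A y) + (y / 4 * A y ^ 3 - 3 / 16 * A y ^ 5)) y)
    (hA0 : |A 0| < profileThreshold) (hD0 : D 0 = 0) :
    ∀ y ∈ Ioo (-T) T, profileSize y (A y) (D y) ≤ 1 / 200 := by
  intro y hy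
  obtain ⟨b, hyb, hbT⟩ : ∃ b, |y| < b ∧ b < T := exists_between (abs_lt.mpr hy)
  have hb0 : 0 < b := (abs_nonneg y).trans_lt hyb
  have hsub : ∀ s, |s| ≤ b → s ∈ Ioo (-T) T := fun s hs => abs_lt.mp (hs.trans_lt hbT)
  have hS0 : profileSize 0 (A 0) (D 0) ≤ 1 / 200 := by
    simp only [profileSize, bracketInv_zero, hD0]
    have := exp_mul_sq_le_of_abs_lt hA0
    nlinarith [Real.one_le_exp (by norm_num : (0 : ℝ) ≤ 600), sq_nonneg (A 0)]
  have hF0 : profileEnergy 0 (A 0) (D 0) = A 0 ^ 2 / 2 := by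
    simp [profileEnergy, bracketInv_zero, hD0]
  have hcont : ∀ s, |s| ≤ b → ContinuousAt (fun s => profileSize s (A s) (D s)) s := by
    intro s hs
    have h1 := (hA s (hsub s hs)).continuousAt
    have h2 := (hD s (hsub s hs)).continuousAt
    have h3 := (hasDerivAt_bracketInv s).continuousAt
    unfold profileSize
    fun_prop
  have hfinal : ∀ s, |s| ≤ b → profileSize s (A s) (D s) ≤ 1 / 100 →
      profileEnergy s (A s) (D s) ≤ Real.exp 600 * (A 0 ^ 2 / 2) →
      profileSize s (A s) (D s) ≤ 1 / 200 := by
    intro s hs h1 h2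
    have h3 := profileSize_le_profileEnergy h1
    have := exp_mul_sq_le_of_abs_lt hA0
    linarith
  have hderiv : ∀ s, profileSize s (A s) (D s) ≤ 1 / 100 →
      |profileEnergyDeriv s (A s) (D s)| ≤
        600 * bracketInv s ^ 3 * profileEnergy s (A s) (D s) := by
    intro s h1
    refine (abs_profileEnergyDeriv_le (by linarith)).trans ?_
    have h3 := profileSize_le_profileEnergy h1
    have h4 : 0 < bracketInv s ^ 3 := pow_pos (bracketInv_pos s) 3
    nlinarith
  -- Both half-lines are treated at once through the maximum of the sizes at `s` and `-s`.
  have key := le_of_bootstrap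
    (φ := fun s => max (profileSize s (A s) (D s)) (profileSize (-s) (A (-s)) (D (-s))))
    (T := b) (R := 1 / 200) (R' := 1 / 100) (by norm_num) ?_ (by simpa using hS0) ?_
  · have := key |y| ⟨abs_nonneg y, hyb⟩
    rcases abs_choice y with h | h <;> rw [h] at this
    · exact (le_max_left _ _).trans this
    · simpa using (le_max_right _ _).trans this
  · refine ContinuousOn.sup (fun s hs => ?_) (fun s hs => ?_)
    · exact (hcont s (by rw [abs_of_nonneg hs.1]; exact hs.2)).continuousWithinAt
    · have h1 := hcont (-s) (by rw [abs_neg, abs_of_nonneg hs.1]; exact hs.2)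
      exact (ContinuousAt.comp (f := fun x : ℝ => -x) h1
        continuous_neg.continuousAt).continuousWithinAt
  · intro t ht hbd s hs
    have hle : ∀ x ∈ Icc 0 s, |x| ≤ b := fun x hx => by
      rw [abs_of_nonneg hx.1]; linarith [hx.2, hs.2, ht.2]
    have hbd' : ∀ x ∈ Icc 0 s, max (profileSize x (A x) (D x))
        (profileSize (-x) (A (-x)) (D (-x))) ≤ 1 / 100 :=
      fun x hx => hbd x ⟨hx.1, hx.2.trans_lt hs.2⟩
    have hs' : s ∈ Icc 0 s := ⟨hs.1, le_rfl⟩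
    refine max_le ?_ ?_
    · refine hfinal s (hle s hs') ((le_max_left _ _).trans (hbd' s hs')) ?_
      rw [← hF0]
      exact le_exp_mul_of_abs_deriv_le (F := fun x => profileEnergy x (A x) (D x)) hs.1
        (by norm_num)
        (fun x hx => hasDerivAt_profileEnergy (hA x (hsub x (hle x hx))) (hD x (hsub x (hle x hx))))
        (fun x hx => hderiv x ((le_max_left _ _).trans (hbd' x hx)))
        (by rw [hF0]; positivity)
    · have hle' : ∀ x ∈ Icc 0 s, |-x| ≤ b := fun x hx => by rw [abs_neg]; exact hle x hx
      refine hfinal (-s) (hle' s hs') ((le_max_right _ _).trans (hbd' s hs')) ?_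
      rw [← hF0]
      have := le_exp_mul_of_abs_deriv_le (c := 600) (b := s)
        (F := fun x => profileEnergy (-x) (A (-x)) (D (-x)))
        (F' := fun x => -profileEnergyDeriv (-x) (A (-x)) (D (-x))) hs.1
        (by norm_num)
        (fun x hx => ?_)
        (fun x hx => ?_)
        (by rw [neg_zero, hF0]; positivity)
      · simpa using this
      · have h1 := hasDerivAt_profileEnergy (hA (-x) (hsub _ (hle' x hx)))
          (hD (-x) (hsub _ (hle' x hx)))
        have h2 := HasDerivAt.comp x h1 (hasDerivAt_neg x)
        exact h2.congr_deriv (by ring)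
      · rw [abs_neg, ← bracketInv_neg x]
        exact hderiv (-x) ((le_max_right _ _).trans (hbd' x hx))

/-! ### Global existence for small data -/

/-- The amplitude equation as an autonomous system for `(y, A, A')`. -/
noncomputable def profileField (p : ℝ × ℝ × ℝ) : ℝ × ℝ × ℝ :=
  (1, p.2.2, -(p.1 ^ 2 / 16 * p.2.1) + (p.1 / 4 * p.2.1 ^ 3 - 3 / 16 * p.2.1 ^ 5))

theorem contDiff_profileField : ContDiff ℝ 1 profileField := by
  unfold profileField
  fun_prop

theorem hasDerivAt_profileField_iff {γ : ℝ → ℝ × ℝ × ℝ} {t : ℝ} :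
    HasDerivAt γ (profileField (γ t)) t ↔
      HasDerivAt (fun s => (γ s).1) 1 t ∧ HasDerivAt (fun s => (γ s).2.1) (γ t).2.2 t ∧
      HasDerivAt (fun s => (γ s).2.2) (-((γ t).1 ^ 2 / 16 * (γ t).2.1) +
        ((γ t).1 / 4 * (γ t).2.1 ^ 3 - 3 / 16 * (γ t).2.1 ^ 5)) t := by
  constructor
  · intro h
    exact ⟨h.fst, h.snd.fst, h.snd.snd⟩
  · rintro ⟨h1, h2, h3⟩
    exact h1.prodMk (h2.prodMk h3)

theorem eq_of_hasDerivAt_one_Ioo {τ : ℝ → ℝ} {T : ℝ} (h0 : τ 0 = 0)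
    (h : ∀ s ∈ Ioo (-T) T, HasDerivAt τ 1 s) : ∀ s ∈ Ioo (-T) T, τ s = s := by
  intro s hs
  have h00 : (0 : ℝ) ∈ Ioo (-T) T := by constructor <;> linarith [hs.1, hs.2]
  have := isOpen_Ioo.is_const_of_deriv_eq_zero (f := fun x => τ x - x) isPreconnected_Ioo
    (fun x hx => ((h x hx).sub (hasDerivAt_id' x)).differentiableAt.differentiableWithinAt)
    (fun x hx => ((h x hx).sub (hasDerivAt_id' x)).deriv.trans (sub_self 1)) hs h00
  simp only [h0, sub_zero] at this
  linarith

/-- Global existence for small data. -/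
theorem exists_profile {A₀ : ℝ} (hA₀ : |A₀| < profileThreshold) :
    ∃ A D : ℝ → ℝ, (∀ y, HasDerivAt A (D y) y) ∧
      (∀ y, HasDerivAt D (-(y ^ 2 / 16 * A y) + (y / 4 * A y ^ 3 - 3 / 16 * A y ^ 5)) y) ∧
      A 0 = A₀ ∧ D 0 = 0 ∧ ∀ y, profileSize y (A y) (D y) ≤ 1 / 200 := by
  obtain ⟨γ, h0, hγ⟩ := exists_forall_hasDerivAt_of_bound contDiff_profileField
    (0, A₀, 0) fun T => by
      -- The bound has to grow with `T`: one component is time itself, and `k D² ≤ 1/200` only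
      -- controls `D` by a power of `1 + |T|`.
      refine ⟨|A₀| + |T| + 1, ?_, ?_⟩
      · simp only [Prod.norm_mk, norm_zero, Real.norm_eq_abs]
        have := abs_nonneg T
        have := abs_nonneg A₀
        exact max_le (by linarith) (max_le (by linarith) (by linarith))
      · intro γ t ht h0 hγ s hs
        simp only [hasDerivAt_profileField_iff] at hγ
        have hτ := eq_of_hasDerivAt_one_Ioo (by rw [h0]) fun s hs => (hγ s hs).1
        have hsize := profileSize_le_of_hasDerivAt (fun s hs => (hγ s hs).2.1)
          (fun s hs => by simpa only [hτ s hs] using (hγ s hs).2.2)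
          (by rw [h0]; exact hA₀) (by rw [h0]) s hs
        have hk := bracketInv_pos s
        have hk1 := bracketInv_le_one s
        have hk2 := bracketInv_sq s
        have ha := sq_le_bracketInv_mul_profileSize s (γ s).2.1 (γ s).2.2
        have hd := bracketInv_mul_sq_le_profileSize s (γ s).2.1 (γ s).2.2
        have hst : |s| ≤ |T| := (abs_lt.mpr hs).le.trans (ht.trans (le_abs_self T))
        have hT := abs_nonneg T
        have hA := abs_nonneg A₀
        set k := bracketInv s
        have ha2 : (γ s).2.1 ^ 2 ≤ 1 := by nlinarith
        have hd2 : (γ s).2.2 ^ 2 ≤ (1 + |T|) ^ 2 := by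
          have h1 : s ^ 2 ≤ |T| ^ 2 := by
            rw [← sq_abs s]; exact pow_le_pow_left₀ (abs_nonneg s) hst 2
          have h2 : 1 ≤ k * (1 + |T|) := by
            rw [← one_le_sq_iff₀ (by positivity), mul_pow, ← hk2]
            gcongr
            nlinarith
          by_contra! hcon
          nlinarith
        rw [Prod.norm_def, Prod.norm_def]
        refine max_le ?_ (max_le ?_ ?_)
        · rw [hτ s hs, Real.norm_eq_abs]; linarith
        · rw [Real.norm_eq_abs]
          have := abs_le_of_sq_le_sq (a := (γ s).2.1) (b := 1) (by simpa using ha2) (by norm_num)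
          linarith
        · rw [Real.norm_eq_abs]
          have := abs_le.mpr (abs_le_of_sq_le_sq' hd2 (by linarith))
          linarith
  simp only [hasDerivAt_profileField_iff] at hγ
  have hτ : ∀ s, (γ s).1 = s := fun s =>
    eq_of_hasDerivAt_one_Ioo (T := |s| + 1) (by rw [h0]) (fun s _ => (hγ s).1) s
      (abs_lt.mp (lt_add_one _))
  have hA : ∀ y, HasDerivAt (fun s => (γ s).2.1) (γ y).2.2 y := fun y => (hγ y).2.1
  have hD : ∀ y, HasDerivAt (fun s => (γ s).2.2) (-(y ^ 2 / 16 * (γ y).2.1) +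
      (y / 4 * (γ y).2.1 ^ 3 - 3 / 16 * (γ y).2.1 ^ 5)) y := fun y => by
    simpa only [hτ y] using (hγ y).2.2
  refine ⟨fun s => (γ s).2.1, fun s => (γ s).2.2, hA, hD, by simp [h0], by simp [h0], fun y => ?_⟩
  exact profileSize_le_of_hasDerivAt (T := |y| + 1) (fun s _ => hA s) (fun s _ => hD s)
    (by rw [h0]; exact hA₀) (by rw [h0]) y (abs_lt.mp (lt_add_one _))

/-! ### Convergence of amplitude and phase -/

/-- A function whose derivative is `O(y⁻³)` converges at infinity with rate `O(y⁻²)`. -/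
theorem exists_norm_sub_le_of_norm_deriv_le {E : Type*} [NormedAddCommGroup E] [NormedSpace ℝ E]
    [CompleteSpace E] {f f' : ℝ → E} {C : ℝ} (hf : ∀ y, 1 ≤ y → HasDerivAt f (f' y) y)
    (hC : ∀ y, 1 ≤ y → ‖f' y‖ ≤ C / y ^ 3) :
    ∃ l : E, ∀ y, 1 ≤ y → ‖f y - l‖ ≤ C / y ^ 2 := by
  have hC0 : 0 ≤ C := by simpa using (norm_nonneg _).trans (hC 1 le_rfl)
  have hinc : ∀ a b, 1 ≤ a → a ≤ b → ‖f b - f a‖ ≤ C / a ^ 2 := by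
    intro a b ha hab
    have hB : ∀ x ∈ Icc a b, HasDerivAt (fun x => C / 2 * ((a ^ 2)⁻¹ - (x ^ 2)⁻¹)) (C / x ^ 3) x := by
      intro x hx
      have hx0 : x ≠ 0 := by linarith [hx.1]
      have h1 := (((hasDerivAt_pow 2 x).inv (pow_ne_zero 2 hx0)).const_sub ((a ^ 2)⁻¹)).const_mul
        (C / 2)
      refine h1.congr_deriv ?_
      push_cast
      field_simp
    have := image_norm_le_of_norm_deriv_right_le_deriv_boundary' (f := fun x => f x - f a)
      (f' := f') (a := a) (b := b) (B := fun x => C / 2 * ((a ^ 2)⁻¹ - (x ^ 2)⁻¹))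
      (B' := fun x => C / x ^ 3)
      (fun x hx => ((hf x (ha.trans hx.1)).sub_const _).continuousAt.continuousWithinAt)
      (fun x hx => ((hf x (ha.trans hx.1)).sub_const _).hasDerivWithinAt)
      (by simp) (fun x hx => (hB x hx).continuousAt.continuousWithinAt)
      (fun x hx => (hB x ⟨hx.1, hx.2.le⟩).hasDerivWithinAt)
      (fun x hx => hC x (ha.trans hx.1)) (right_mem_Icc.mpr hab)
    refine this.trans ?_
    have h1 : 0 ≤ (b ^ 2)⁻¹ := by positivity
    have h2 : 0 ≤ (a ^ 2)⁻¹ := by positivity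
    rw [div_eq_mul_inv C (a ^ 2)]
    nlinarith [mul_nonneg hC0 h1, mul_nonneg hC0 h2]
  have hlim : Tendsto (fun y : ℝ => C / (max y 1) ^ 2) atTop (𝓝 0) := by
    refine Tendsto.div_atTop tendsto_const_nhds ((tendsto_pow_atTop two_ne_zero).comp ?_)
    exact tendsto_atTop_mono (fun y => le_max_left y 1) tendsto_id
  have hcau : CauchySeq fun y : ℝ => f (max y 1) := by
    refine cauchySeq_of_le_tendsto_0' _ (fun n m hnm => ?_) hlim
    rw [dist_comm, dist_eq_norm]
    exact hinc _ _ (le_max_right _ _) (max_le_max_right 1 hnm)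
  obtain ⟨l, hl⟩ := cauchySeq_tendsto_of_complete hcau
  refine ⟨l, fun y hy => ?_⟩
  rw [norm_sub_rev]
  refine le_of_tendsto (hl.sub_const (f y)).norm ?_
  filter_upwards [eventually_ge_atTop y] with x hx
  rw [max_eq_left (hy.trans hx)]
  exact hinc y x hy hx

theorem tendsto_of_norm_sub_le_div_sq {E : Type*} [NormedAddCommGroup E] {f : ℝ → E} {l : E}
    {C : ℝ} (h : ∀ y, 1 ≤ y → ‖f y - l‖ ≤ C / y ^ 2) : Tendsto f atTop (𝓝 l) := by
  rw [tendsto_iff_norm_sub_tendsto_zero]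
  refine squeeze_zero' (Eventually.of_forall fun _ => norm_nonneg _)
    ((eventually_ge_atTop 1).mono fun y hy => h y hy) ?_
  exact Tendsto.div_atTop tendsto_const_nhds (tendsto_pow_atTop two_ne_zero)

/-- Phase correction: a nearly conserved amplitude with a rotation speed proportional to
`‖W‖² / y` has a limit profile with a logarithmic phase. -/
theorem exists_amplitude_phase {W r : ℝ → ℂ} {m : ℝ → ℝ} {κ C : ℝ}
    (hW : ∀ y, 1 ≤ y → HasDerivAt W (Complex.I * (κ / y * m y : ℝ) * W y + r y) y)
    (hr : ∀ y, 1 ≤ y → ‖r y‖ ≤ C / y ^ 3) (hWC : ∀ y, 1 ≤ y → ‖W y‖ ≤ C)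
    (hm : ∀ y, 1 ≤ y → |m y - ‖W y‖ ^ 2| ≤ C / y ^ 2) :
    ∃ Q ω C' : ℝ, ∀ y, 1 ≤ y →
      ‖W y - Q * Complex.exp (Complex.I * (ω + κ * Q ^ 2 * Real.log y : ℝ))‖ ≤ C' / y ^ 2 := by
  have hC0 : 0 ≤ C := (norm_nonneg _).trans (hWC 1 le_rfl)
  -- The rotation term is orthogonal to `W`, so only `r` changes the modulus.
  obtain ⟨L, hL⟩ := exists_norm_sub_le_of_norm_deriv_le (f := fun y => ‖W y‖ ^ 2)
    (f' := fun y => 2 * inner ℝ (W y) (r y)) (C := 2 * C * C)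
    (fun y hy => by
      refine (hW y hy).norm_sq.congr_deriv ?_
      have : inner ℝ (W y) (Complex.I * (κ / y * m y : ℝ) * W y) = 0 := by
        rw [Complex.inner]
        simp only [Complex.mul_re, Complex.mul_im, Complex.conj_re, Complex.conj_im,
          Complex.I_re, Complex.I_im, Complex.ofReal_re, Complex.ofReal_im]
        ring
      rw [inner_add_right, this, zero_add])
    (fun y hy => by
      rw [norm_mul, Real.norm_ofNat]
      calc 2 * ‖inner ℝ (W y) (r y)‖ ≤ 2 * (‖W y‖ * ‖r y‖) := by
            gcongr; exact norm_inner_le_norm _ _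
        _ ≤ 2 * (C * (C / y ^ 3)) := by gcongr; exacts [hWC y hy, hr y hy]
        _ = _ := by ring)
  have hLlim := tendsto_of_norm_sub_le_div_sq hL
  have hexp : ∀ y, 1 ≤ y →
      HasDerivAt (fun y : ℝ => Complex.exp (-Complex.I * (κ * L * Real.log y : ℝ)))
      (Complex.exp (-Complex.I * (κ * L * Real.log y : ℝ)) * (-Complex.I * (κ * L / y : ℝ))) y := by
    intro y hy
    have h1 := ((Real.hasDerivAt_log (by linarith : y ≠ 0)).const_mul (κ * L)).ofReal_comp
    exact (h1.const_mul (-Complex.I)).cexp.congr_deriv (by rw [div_eq_mul_inv])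
  have hnorm : ∀ x : ℝ, ‖Complex.exp (-Complex.I * x)‖ = 1 := fun x => by
    rw [Complex.norm_exp]; simp
  have hnorm' : ∀ x : ℝ, ‖Complex.exp (Complex.I * x)‖ = 1 := fun x => by
    rw [Complex.norm_exp]; simp
  -- Replacing `m` by its limit `L` costs `O(y⁻³)` in the derivative, so rotating back by `κ L log
  -- y` leaves a convergent function.
  obtain ⟨V, hV⟩ := exists_norm_sub_le_of_norm_deriv_le
    (f := fun y : ℝ => Complex.exp (-Complex.I * (κ * L * Real.log y : ℝ)) * W y)
    (f' := fun y : ℝ => Complex.exp (-Complex.I * (κ * L * Real.log y : ℝ)) *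
      (Complex.I * (κ / y * (m y - L) : ℝ) * W y + r y))
    (C := |κ| * (C + 2 * C * C) * C + C)
    (fun y hy => by
      refine ((hexp y hy).mul (hW y hy)).congr_deriv ?_
      push_cast
      ring)
    (fun y hy => by
      have hy0 : 0 < y := by linarith
      rw [norm_mul, hnorm, one_mul]
      refine (norm_add_le _ _).trans ?_
      rw [norm_mul, norm_mul, Complex.norm_I, one_mul, Complex.norm_real, Real.norm_eq_abs,
        abs_mul, abs_div, abs_of_pos hy0]
      have h1 : |m y - L| ≤ (C + 2 * C * C) / y ^ 2 := by
        have := abs_add_le (m y - ‖W y‖ ^ 2) (‖W y‖ ^ 2 - L)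
        rw [sub_add_sub_cancel] at this
        refine this.trans ?_
        rw [add_div]
        exact add_le_add (hm y hy) (hL y hy)
      calc |κ| / y * |m y - L| * ‖W y‖ + ‖r y‖
          ≤ |κ| / y * ((C + 2 * C * C) / y ^ 2) * C + C / y ^ 3 := by
            gcongr; exacts [hWC y hy, hr y hy]
        _ = _ := by field_simp)
  have hVlim := tendsto_of_norm_sub_le_div_sq hV
  -- This ties the logarithmic coefficient to the amplitude: `L = Q²` with `Q = ‖V‖`.
  have hVL : ‖V‖ ^ 2 = L := by
    refine tendsto_nhds_unique (hVlim.norm.pow 2) (hLlim.congr fun y => ?_)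
    rw [norm_mul, hnorm, one_mul]
  refine ⟨‖V‖, V.arg, _, fun y hy => le_trans (le_of_eq ?_) (hV y hy)⟩
  have h1 : W y = Complex.exp (Complex.I * (κ * L * Real.log y : ℝ)) *
      (Complex.exp (-Complex.I * (κ * L * Real.log y : ℝ)) * W y) := by
    rw [← mul_assoc, ← Complex.exp_add, neg_mul, add_neg_cancel, Complex.exp_zero, one_mul]
  have h2 : (‖V‖ : ℂ) * Complex.exp (Complex.I * (V.arg + κ * ‖V‖ ^ 2 * Real.log y : ℝ)) =
      Complex.exp (Complex.I * (κ * L * Real.log y : ℝ)) * V := by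
    conv_rhs => rw [← Complex.norm_mul_exp_arg_mul_I V]
    rw [hVL, Complex.ofReal_add, mul_add, Complex.exp_add, mul_comm Complex.I (V.arg : ℂ)]
    ring
  rw [h2]
  conv_rhs => rw [← one_mul ‖_‖, ← hnorm' (κ * L * Real.log y), ← norm_mul, mul_sub, ← h1]

/-! ### Normal form and the resonant cubic term -/

/-- The cubic normal form of the oscillator. -/
theorem exists_oscillator_asymptotics {u v ρ : ℝ → ℝ} {σ C : ℝ} (hσ : |σ| ≤ 1)
    (hu : ∀ y, 1 ≤ y → HasDerivAt u (y / 4 * v y) y)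
    (hv : ∀ y, 1 ≤ y → HasDerivAt v (-(y / 4 * u y) + (σ * u y ^ 3 / y + ρ y)) y)
    (hρ : ∀ y, 1 ≤ y → |ρ y| ≤ C / y ^ 3) (huC : ∀ y, 1 ≤ y → |u y| ≤ C)
    (hvC : ∀ y, 1 ≤ y → |v y| ≤ C) :
    ∃ Q ω C' : ℝ, ∀ y, 1 ≤ y →
      |u y - Q * Real.cos (ω - y ^ 2 / 8 + σ * (3 / 16) * Q ^ 2 * Real.log (y ^ 2 / 8))|
        ≤ C' / y ^ 2 := by
  have hC0 : 0 ≤ C := (abs_nonneg _).trans (huC 1 le_rfl)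
  let z : ℝ → ℂ := fun y => u y + Complex.I * v y
  let c : ℝ → ℂ := fun y => u y - Complex.I * v y
  let N : ℝ → ℝ := fun y => σ * u y ^ 3 / y + ρ y
  -- Here `c` is the conjugate of `z`. To leading order `z³`, `z c²`, `c³` rotate at `-3`, `1`, `3`
  -- times `y/4`, against `-1` for `z`. Dividing their coefficients `1`, `3`, `1` in `(z + c)³` by
  -- the differences `-2`, `2`, `4` gives `p`; `z² c` has difference `0` and must stay.
  let p : ℝ → ℂ := fun y => -z y ^ 3 / 2 + 3 / 2 * (z y * c y ^ 2) + c y ^ 3 / 4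
  let g : ℝ → ℂ := fun y => -(3 / 2) * z y ^ 2 + 3 / 4 * c y ^ 2 - 3 * (z y * c y)
  let e : ℝ → ℂ := fun y => Complex.exp (Complex.I * (y ^ 2 / 8 : ℝ))
  have hz : ∀ y, 1 ≤ y → HasDerivAt z (-Complex.I * (y / 4) * z y + Complex.I * N y) y := by
    intro y hy
    refine ((hu y hy).ofReal_comp.add ((hv y hy).ofReal_comp.const_mul Complex.I)).congr_deriv ?_
    simp only [z, N]
    push_cast
    linear_combination (y / 4 * v y : ℂ) * Complex.I_sq
  have hc : ∀ y, 1 ≤ y → HasDerivAt c (Complex.I * (y / 4) * c y - Complex.I * N y) y := by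
    intro y hy
    refine ((hu y hy).ofReal_comp.sub ((hv y hy).ofReal_comp.const_mul Complex.I)).congr_deriv ?_
    simp only [c, N]
    push_cast
    linear_combination (y / 4 * v y : ℂ) * Complex.I_sq
  have he : ∀ y, HasDerivAt e (e y * (Complex.I * (y / 4))) y := by
    intro y
    have h1 := (((hasDerivAt_pow 2 y).div_const 8).ofReal_comp.const_mul Complex.I).cexp
    refine h1.congr_deriv ?_
    simp only [e]
    push_cast
    ring
  have hzC : ∀ y, 1 ≤ y → ‖z y‖ ≤ 2 * C := by
    intro y hy
    refine (norm_add_le _ _).trans ?_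
    rw [norm_mul, Complex.norm_I, one_mul, Complex.norm_real, Complex.norm_real]
    have h1 := huC y hy
    have h2 := hvC y hy
    simp only [Real.norm_eq_abs]
    linarith
  have hcC : ∀ y, 1 ≤ y → ‖c y‖ ≤ 2 * C := by
    intro y hy
    refine (norm_sub_le _ _).trans ?_
    rw [norm_mul, Complex.norm_I, one_mul, Complex.norm_real, Complex.norm_real]
    have h1 := huC y hy
    have h2 := hvC y hy
    simp only [Real.norm_eq_abs]
    linarith
  have hpC : ∀ y, 1 ≤ y → ‖p y‖ ≤ 3 * (2 * C) ^ 3 := by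
    intro y hy
    have h1 := hzC y hy
    have h2 := hcC y hy
    calc ‖p y‖ ≤ ‖z y‖ ^ 3 / 2 + 3 / 2 * (‖z y‖ * ‖c y‖ ^ 2) + ‖c y‖ ^ 3 / 4 := by
          refine (norm_add_le _ _).trans (add_le_add ((norm_add_le _ _).trans
            (add_le_add ?_ ?_)) ?_) <;> simp
      _ ≤ (2 * C) ^ 3 / 2 + 3 / 2 * ((2 * C) * (2 * C) ^ 2) + (2 * C) ^ 3 / 4 := by gcongr
      _ ≤ _ := by nlinarith [pow_nonneg hC0 3]
  have hgC : ∀ y, 1 ≤ y → ‖g y‖ ≤ 6 * (2 * C) ^ 2 := by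
    intro y hy
    have h1 := hzC y hy
    have h2 := hcC y hy
    calc ‖g y‖ ≤ 3 / 2 * ‖z y‖ ^ 2 + 3 / 4 * ‖c y‖ ^ 2 + 3 * (‖z y‖ * ‖c y‖) := by
          refine (norm_sub_le _ _).trans (add_le_add ((norm_add_le _ _).trans
            (add_le_add ?_ ?_)) ?_) <;> simp
      _ ≤ 3 / 2 * (2 * C) ^ 2 + 3 / 4 * (2 * C) ^ 2 + 3 * ((2 * C) * (2 * C)) := by gcongr
      _ ≤ _ := by nlinarith [pow_nonneg hC0 2]
  have hNC : ∀ y, 1 ≤ y → |N y| ≤ (C ^ 3 + C) / y := by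
    intro y hy
    have hy0 : 0 < y := by linarith
    refine (abs_add_le _ _).trans ?_
    rw [add_div, abs_div, abs_mul, abs_pow, abs_of_pos hy0]
    have h1 : C / y ^ 3 ≤ C / y := by
      gcongr
      exact le_self_pow₀ hy (by norm_num)
    have h2 : |σ| * |u y| ^ 3 ≤ 1 * C ^ 3 := by gcongr; exact huC y hy
    rw [one_mul] at h2
    exact add_le_add (by gcongr) ((hρ y hy).trans h1)
  let Z : ℝ → ℂ := fun y => z y - (σ / 2 : ℝ) * ((y ^ 2 : ℝ) : ℂ)⁻¹ * p y
  let R : ℝ → ℂ := fun y => Complex.I * ρ y + (σ : ℂ) * ((y ^ 3 : ℝ) : ℂ)⁻¹ * p y -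
    (σ / 2 : ℝ) * ((y ^ 2 : ℝ) : ℂ)⁻¹ * (Complex.I * N y * g y)
  have hp : ∀ y, 1 ≤ y → HasDerivAt p (Complex.I * (y / 4) *
      (3 / 2 * z y ^ 3 + 3 / 2 * (z y * c y ^ 2) + 3 / 4 * c y ^ 3) + Complex.I * N y * g y) y := by
    intro y hy
    have h1 := hz y hy
    have h2 := hc y hy
    refine ((((h1.pow 3).neg.div_const 2).add ((h1.mul (h2.pow 2)).const_mul (3 / 2))).add
      ((h2.pow 3).div_const 4)).congr_deriv ?_
    simp only [g, Pi.pow_apply]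
    push_cast
    ring
  have hZ : ∀ y, 1 ≤ y → HasDerivAt Z (-Complex.I * (y / 4) * Z y +
      Complex.I * (3 * σ / 8 / y : ℝ) * (z y ^ 2 * c y) + R y) y := by
    intro y hy
    have hy0 : (y : ℂ) ≠ 0 := by exact_mod_cast (by linarith : y ≠ 0)
    have h1 : HasDerivAt (fun y : ℝ => ((y ^ 2 : ℝ) : ℂ)⁻¹) (-2 * ((y ^ 3 : ℝ) : ℂ)⁻¹) y := by
      have := (hasDerivAt_pow 2 y).ofReal_comp.inv (by push_cast; exact pow_ne_zero 2 hy0)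
      refine this.congr_deriv ?_
      push_cast
      field_simp
    refine ((hz y hy).sub ((h1.const_mul ((σ / 2 : ℝ) : ℂ)).mul (hp y hy))).congr_deriv ?_
    have huz : (u y : ℂ) = (z y + c y) / 2 := by simp only [z, c]; ring
    have hN : (N y : ℂ) = σ * ((z y + c y) / 2) ^ 3 / y + ρ y := by
      rw [← huz]; simp only [N]; push_cast; ring
    simp only [Z, R]
    have hps : p y = -z y ^ 3 / 2 + 3 / 2 * (z y * c y ^ 2) + c y ^ 3 / 4 := rfl
    generalize hG : Complex.I * N y * g y = G
    rw [hN, hps]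
    push_cast
    field_simp
    ring
  have hen : ∀ y, ‖e y‖ = 1 := fun y => by
    simp only [e]; rw [mul_comm]; exact Complex.norm_exp_ofReal_mul_I _
  have hzZ : ∀ y, 1 ≤ y → ‖z y - Z y‖ ≤ 12 * C ^ 3 / y ^ 2 := by
    intro y hy
    have hy0 : 0 < y := by linarith
    have h1 : z y - Z y = (σ / 2 : ℝ) * ((y ^ 2 : ℝ) : ℂ)⁻¹ * p y := by simp only [Z]; ring
    rw [h1, norm_mul, norm_mul, norm_inv, Complex.norm_real, Complex.norm_real,
      Real.norm_eq_abs, Real.norm_eq_abs, abs_of_pos (by positivity : 0 < y ^ 2), abs_div,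
      abs_two]
    calc |σ| / 2 * (y ^ 2)⁻¹ * ‖p y‖ ≤ 1 / 2 * (y ^ 2)⁻¹ * (3 * (2 * C) ^ 3) := by
          gcongr; exact hpC y hy
      _ = _ := by field_simp; ring
  have hRC : ∀ y, 1 ≤ y → ‖R y‖ ≤ (C + 24 * C ^ 3 + 12 * (C ^ 3 + C) * C ^ 2) / y ^ 3 := by
    intro y hy
    have hy0 : 0 < y := by linarith
    have h1 : ‖Complex.I * ρ y‖ ≤ C / y ^ 3 := by
      rw [norm_mul, Complex.norm_I, one_mul, Complex.norm_real]
      exact hρ y hy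
    have h2 : ‖(σ : ℂ) * ((y ^ 3 : ℝ) : ℂ)⁻¹ * p y‖ ≤ 1 * (y ^ 3)⁻¹ * (3 * (2 * C) ^ 3) := by
      rw [norm_mul, norm_mul, norm_inv, Complex.norm_real, Complex.norm_real,
        Real.norm_eq_abs, Real.norm_eq_abs, abs_of_pos (by positivity : 0 < y ^ 3)]
      gcongr
      exact hpC y hy
    have h3 : ‖(σ / 2 : ℝ) * ((y ^ 2 : ℝ) : ℂ)⁻¹ * (Complex.I * N y * g y)‖ ≤
        1 / 2 * (y ^ 2)⁻¹ * ((C ^ 3 + C) / y * (6 * (2 * C) ^ 2)) := by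
      rw [norm_mul, norm_mul, norm_mul, norm_mul, norm_inv, Complex.norm_I, one_mul,
        Complex.norm_real, Complex.norm_real, Complex.norm_real, Real.norm_eq_abs,
        Real.norm_eq_abs, Real.norm_eq_abs, abs_of_pos (by positivity : 0 < y ^ 2), abs_div,
        abs_two]
      gcongr
      exacts [hNC y hy, hgC y hy]
    refine (norm_sub_le _ _).trans ((add_le_add ((norm_add_le _ _).trans
      (add_le_add h1 h2)) h3).trans (le_of_eq ?_))
    field_simp
    ring
  have hZC : ∀ y, 1 ≤ y → ‖Z y‖ ≤ 2 * C + 12 * C ^ 3 := by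
    intro y hy
    have h1 := norm_sub_norm_le (Z y) (z y)
    rw [norm_sub_rev (Z y)] at h1
    have h2 : 12 * C ^ 3 / y ^ 2 ≤ 12 * C ^ 3 :=
      div_le_self (by positivity) (one_le_pow₀ hy)
    linarith [hzZ y hy, hzC y hy]
  obtain ⟨K, hK1, hK2, hK3⟩ : ∃ K, 2 * C + 12 * C ^ 3 ≤ K ∧
      C + 24 * C ^ 3 + 12 * (C ^ 3 + C) * C ^ 2 + 3 / 8 * (2 * C) ^ 2 * (12 * C ^ 3) ≤ K ∧
      12 * C ^ 3 * (4 * C + 12 * C ^ 3) ≤ K :=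
    ⟨max (max _ _) _, (le_max_left _ _).trans (le_max_left _ _),
      (le_max_right _ _).trans (le_max_left _ _), le_max_right _ _⟩
  -- The factor `e` removes the phase `-y²/8`. The coefficient `3σ/8` is that of `z² c` in `σ ((z +
  -- c) / 2)³`, and the second part of `r` pays for writing `Z` instead of `z` in the resonant term.
  obtain ⟨Q, ω, C', hfin⟩ := exists_amplitude_phase (W := fun y => e y * Z y)
    (r := fun y => e y * R y + Complex.I * (3 * σ / 8 / y * ‖z y‖ ^ 2 : ℝ) * (e y * (z y - Z y)))
    (m := fun y => ‖z y‖ ^ 2) (κ := 3 * σ / 8) (C := K)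
    (fun y hy => by
      have hzc : z y * c y = ((‖z y‖ ^ 2 : ℝ) : ℂ) := by
        have : c y = (starRingEnd ℂ) (z y) := by
          simp only [z, c, map_add, map_mul, Complex.conj_I, Complex.conj_ofReal]; ring
        rw [this, Complex.mul_conj, Complex.normSq_eq_norm_sq]
      refine ((he y).mul (hZ y hy)).congr_deriv ?_
      have h1 : z y ^ 2 * c y = ((‖z y‖ ^ 2 : ℝ) : ℂ) * z y := by rw [← hzc]; ring
      rw [h1]
      push_cast
      ring)
    (fun y hy => by
      have hy0 : 0 < y := by linarith
      have h1 : ‖Complex.I * (3 * σ / 8 / y * ‖z y‖ ^ 2 : ℝ) * (e y * (z y - Z y))‖ ≤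
          3 / 8 / y * (2 * C) ^ 2 * (12 * C ^ 3 / y ^ 2) := by
        rw [norm_mul, norm_mul, norm_mul, hen, Complex.norm_I, one_mul, one_mul,
          Complex.norm_real, Real.norm_eq_abs, abs_mul, abs_div, abs_div, abs_mul,
          abs_of_pos hy0, abs_of_nonneg (sq_nonneg ‖z y‖)]
        have h2 : |(3 : ℝ)| * |σ| / |(8 : ℝ)| ≤ 3 / 8 := by
          rw [abs_of_pos (by norm_num : (0 : ℝ) < 3), abs_of_pos (by norm_num : (0 : ℝ) < 8)]
          linarith
        gcongr
        exacts [hzC y hy, hzZ y hy]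
      have h3 : ‖e y * R y‖ ≤ (C + 24 * C ^ 3 + 12 * (C ^ 3 + C) * C ^ 2) / y ^ 3 := by
        rw [norm_mul, hen, one_mul]; exact hRC y hy
      refine (norm_add_le _ _).trans ((add_le_add h3 h1).trans ?_)
      calc _ = (C + 24 * C ^ 3 + 12 * (C ^ 3 + C) * C ^ 2 +
            3 / 8 * (2 * C) ^ 2 * (12 * C ^ 3)) / y ^ 3 := by field_simp
        _ ≤ _ := by gcongr)
    (fun y hy => by rw [norm_mul, hen, one_mul]; exact (hZC y hy).trans hK1)
    (fun y hy => by
      have hy0 : 0 < y := by linarith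
      rw [norm_mul, hen, one_mul, sq_sub_sq, abs_mul, mul_comm]
      have h1 : |‖z y‖ - ‖Z y‖| ≤ 12 * C ^ 3 / y ^ 2 := (abs_norm_sub_norm_le _ _).trans (hzZ y hy)
      have h2 : |‖z y‖ + ‖Z y‖| ≤ 4 * C + 12 * C ^ 3 := by
        rw [abs_of_nonneg (by positivity)]; linarith [hzC y hy, hZC y hy]
      calc _ ≤ 12 * C ^ 3 / y ^ 2 * (4 * C + 12 * C ^ 3) := by gcongr
        _ = 12 * C ^ 3 * (4 * C + 12 * C ^ 3) / y ^ 2 := by ring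
        _ ≤ _ := by gcongr)
  -- Since `2 log y = log (y²/8) + log 8`, the rate `3/8` becomes `3/16` and the constant goes into
  -- the phase.
  refine ⟨Q, ω + σ * (3 / 16) * Q ^ 2 * Real.log 8, C' + 12 * C ^ 3, fun y hy => ?_⟩
  have hy0 : 0 < y := by linarith
  set θ : ℝ := ω + 3 * σ / 8 * Q ^ 2 * Real.log y with hθ
  have hphase : ω + σ * (3 / 16) * Q ^ 2 * Real.log 8 - y ^ 2 / 8 +
      σ * (3 / 16) * Q ^ 2 * Real.log (y ^ 2 / 8) = θ - y ^ 2 / 8 := by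
    rw [Real.log_div (by positivity) (by norm_num), Real.log_pow, hθ]
    push_cast
    ring
  rw [hphase]
  have hre : u y - Q * Real.cos (θ - y ^ 2 / 8) =
      (z y - Q * Complex.exp (Complex.I * (θ - y ^ 2 / 8 : ℝ))).re := by
    rw [Complex.sub_re, Complex.re_ofReal_mul, mul_comm Complex.I, Complex.exp_ofReal_mul_I_re]
    simp [z]
  have hmul : e y * (z y - Q * Complex.exp (Complex.I * (θ - y ^ 2 / 8 : ℝ))) =
      e y * (z y - Z y) + (e y * Z y - Q * Complex.exp (Complex.I * θ)) := by
    have : e y * Complex.exp (Complex.I * (θ - y ^ 2 / 8 : ℝ)) = Complex.exp (Complex.I * θ) := by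
      simp only [e]
      rw [← Complex.exp_add]
      congr 1
      push_cast
      ring
    rw [← this]
    ring
  rw [hre]
  refine (Complex.abs_re_le_norm _).trans ?_
  rw [← one_mul ‖_‖, ← hen y, ← norm_mul, hmul, add_comm C', add_div]
  refine (norm_add_le _ _).trans (add_le_add ?_ (hfin y hy))
  rw [norm_mul, hen, one_mul]
  exact hzZ y hy

/-- Asymptotics at `+∞` of solutions of the amplitude equation of size `O(1)`. -/
theorem exists_isBigO_atTop {A D : ℝ → ℝ} {σ : ℝ} (hσ : |σ| ≤ 1)
    (hA : ∀ y, HasDerivAt A (D y) y)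
    (hD : ∀ y, HasDerivAt D
      (-(y ^ 2 / 16 * A y) + (σ * (y / 4 * A y ^ 3) - 3 / 16 * A y ^ 5)) y)
    (hS : ∀ y, profileSize y (A y) (D y) ≤ 1 / 200) :
    ∃ Q ω : ℝ, (fun y : ℝ => A y - Q * |y| ^ (-(1 / 2) : ℝ) *
      Real.cos (ω - y ^ 2 / 8 + σ * (3 / 16) * Q ^ 2 * Real.log (y ^ 2 / 8)))
        =O[atTop] (fun y : ℝ => y⁻¹) := by
  have hq : ∀ y : ℝ, 1 ≤ y → 1 ≤ √y ∧ √y ^ 2 = y := fun y hy =>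
    ⟨Real.one_le_sqrt.mpr hy, Real.sq_sqrt (by linarith)⟩
  have hsqrt : ∀ y : ℝ, 1 ≤ y → HasDerivAt (fun y => √y) (1 / (2 * √y)) y := fun y hy =>
    Real.hasDerivAt_sqrt (by linarith)
  have huC : ∀ y, 1 ≤ y → |√y * A y| ≤ 1 := by
    intro y hy
    have h1 := sq_le_bracketInv_mul_profileSize y (A y) (D y)
    have h2 := abs_mul_bracketInv_le_one y
    have hk := bracketInv_pos y
    rw [abs_of_nonneg (by linarith)] at h2
    refine abs_le_of_sq_le_sq ?_ zero_le_one
    rw [mul_pow, (hq y hy).2]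
    have h3 := hS y
    calc y * A y ^ 2 ≤ y * (bracketInv y * profileSize y (A y) (D y)) := by gcongr
      _ = (y * bracketInv y) * profileSize y (A y) (D y) := by ring
      _ ≤ 1 * (1 / 200) := by gcongr; exact profileSize_nonneg _ _ _
      _ ≤ _ := by norm_num
  have hDC : ∀ y, 1 ≤ y → |D y / √y| ≤ 1 := by
    intro y hy
    have h1 := bracketInv_mul_sq_le_profileSize y (A y) (D y)
    have hk := bracketInv_pos y
    have hk2 := bracketInv_sq y
    have h2 : 1 / 2 ≤ bracketInv y * y := by
      have : (1 / 2 : ℝ) ^ 2 ≤ (bracketInv y * y) ^ 2 := by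
        have := mul_le_mul_of_nonneg_left (one_le_pow₀ (n := 2) hy) (sq_nonneg (bracketInv y))
        nlinarith
      exact le_of_sq_le_sq this (by positivity)
    refine abs_le_of_sq_le_sq ?_ zero_le_one
    rw [div_pow, (hq y hy).2, one_pow, div_le_one (by linarith)]
    have h3 := hS y
    have h4 : bracketInv y * D y ^ 2 ≤ bracketInv y * y := by linarith
    exact le_of_mul_le_mul_left h4 hk
  have hAq : ∀ y, 1 ≤ y → |A y| ≤ 1 / √y := by
    intro y hy
    have h1 := huC y hy
    have hq1 := (hq y hy).1
    rw [abs_mul, abs_of_pos (by linarith)] at h1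
    rw [le_div_iff₀ (by linarith)]
    linarith
  -- The choice of `v` makes `u' = (y/4) v` exact; `ρ` collects the quintic term and the second
  -- derivative of the weight, both `O(y⁻³)` because `|A| ≤ y^{-1/2}`. The constant `6` is the bound
  -- `4 (1 + 1/2)` for `v`.
  obtain ⟨Q, ω, C', h⟩ := exists_oscillator_asymptotics (u := fun y => √y * A y)
    (v := fun y => 4 * (D y / √y + A y / (2 * √y ^ 3)))
    (ρ := fun y => -(3 / 4 * A y ^ 5 / √y + 3 * A y / √y ^ 5)) (C := 6) hσ
    (fun y hy => by
      obtain ⟨hq1, hq2⟩ := hq y hy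
      refine ((hsqrt y hy).mul (hA y)).congr_deriv ?_
      have hq0 : √y ≠ 0 := by linarith
      generalize √y = q at *
      subst hq2
      field_simp
      ring)
    (fun y hy => by
      obtain ⟨hq1, hq2⟩ := hq y hy
      have hq0 : √y ≠ 0 := by linarith
      refine ((((hD y).div (hsqrt y hy) hq0).add ((hA y).div (((hsqrt y hy).pow 3).const_mul 2)
        (mul_ne_zero two_ne_zero (pow_ne_zero 3 hq0)))).const_mul 4).congr_deriv ?_
      simp only [Pi.pow_apply]
      generalize √y = q at *
      subst hq2
      push_cast
      field_simp
      ring)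
    (fun y hy => by
      obtain ⟨hq1, hq2⟩ := hq y hy
      have hq0 : 0 < √y := by linarith
      have h1 := hAq y hy
      have h2 : |3 / 4 * A y ^ 5 / √y| ≤ 3 / 4 * (1 / √y) ^ 5 / √y := by
        rw [abs_div, abs_mul, abs_pow, abs_of_pos hq0,
          abs_of_pos (by norm_num : (0 : ℝ) < 3 / 4)]
        gcongr
      have h3 : |3 * A y / √y ^ 5| ≤ 3 * (1 / √y) / √y ^ 5 := by
        rw [abs_div, abs_mul, abs_pow, abs_of_pos hq0, abs_of_pos (by norm_num : (0 : ℝ) < 3)]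
        gcongr
      rw [abs_neg]
      refine (abs_add_le _ _).trans ((add_le_add h2 h3).trans ?_)
      have h4 : y ^ 3 = √y ^ 6 := by
        calc y ^ 3 = (√y ^ 2) ^ 3 := by rw [hq2]
          _ = √y ^ 6 := by ring
      rw [h4, div_pow, one_pow]
      have h5 : 3 / 4 * (1 / √y ^ 5) / √y + 3 * (1 / √y) / √y ^ 5 = (15 / 4) / √y ^ 6 := by
        field_simp; ring
      rw [h5]
      gcongr
      norm_num)
    (fun y hy => (huC y hy).trans (by norm_num))
    (fun y hy => by
      obtain ⟨hq1, hq2⟩ := hq y hy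
      have hq0 : 0 < √y := by linarith
      have h1 : |A y / (2 * √y ^ 3)| ≤ 1 / 2 := by
        rw [abs_div, abs_of_pos (by positivity : 0 < 2 * √y ^ 3), div_le_iff₀ (by positivity)]
        have h2 := hAq y hy
        have h3 : 1 / √y ≤ 1 := (div_le_one hq0).mpr hq1
        have h4 : 1 ≤ √y ^ 3 := one_le_pow₀ hq1
        linarith
      have h2 := (abs_add_le (D y / √y) (A y / (2 * √y ^ 3))).trans (add_le_add (hDC y hy) h1)
      rw [abs_mul, abs_of_pos (by norm_num : (0 : ℝ) < 4)]
      linarith)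
  refine ⟨Q, ω, IsBigO.of_bound C' ?_⟩
  filter_upwards [eventually_ge_atTop 1] with y hy
  obtain ⟨hq1, hq2⟩ := hq y hy
  have hy0 : 0 < y := by linarith
  have hq0 : 0 < √y := by linarith
  have h1 := h y hy
  have hC' : 0 ≤ C' := by simpa using (abs_nonneg _).trans (h 1 le_rfl)
  have hpow : |y| ^ (-(1 / 2) : ℝ) = (√y)⁻¹ := by
    rw [abs_of_pos hy0, Real.rpow_neg hy0.le, Real.sqrt_eq_rpow]
  rw [hpow]
  set θ := Real.cos (ω - y ^ 2 / 8 + σ * (3 / 16) * Q ^ 2 * Real.log (y ^ 2 / 8))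
  have h2 : A y - Q * (√y)⁻¹ * θ = (√y)⁻¹ * (√y * A y - Q * θ) := by
    field_simp
  rw [h2, norm_mul, Real.norm_eq_abs, Real.norm_eq_abs, Real.norm_eq_abs, abs_inv,
    abs_of_pos hq0, abs_inv, abs_of_pos hy0]
  calc (√y)⁻¹ * |√y * A y - Q * θ| ≤ 1 * (C' / y ^ 2) := by
        gcongr; exact inv_le_one_of_one_le₀ hq1
    _ ≤ C' / y := by
        rw [one_mul]; gcongr; exact le_self_pow₀ hy two_ne_zero
    _ = C' * y⁻¹ := div_eq_mul_inv _ _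

/-! ### Membership in the space, uniqueness and conclusion -/

theorem japaneseBracket_eq (y : ℝ) : japaneseBracket y = (bracketInv y)⁻¹ := by
  rw [japaneseBracket, bracketInv, inv_inv, sq_abs, Real.sqrt_eq_rpow]

/-- Solutions of bounded size belong to the profile space. -/
theorem mem_profileSpace_of_profileSize_le {A D : ℝ → ℝ} (hA : ∀ y, HasDerivAt A (D y) y)
    (hDc : ContDiff ℝ 1 D) (hS : ∀ y, profileSize y (A y) (D y) ≤ 1) : A ∈ profileSpace := by
  have hderiv : deriv A = D := funext fun y => (hA y).deriv
  have hAc : Continuous A := continuous_iff_continuousAt.mpr fun y => (hA y).continuousAt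
  have hjc : ∀ s : ℝ, Continuous fun y => japaneseBracket y ^ s := by
    intro s
    have h0 : Continuous bracketInv :=
      continuous_iff_continuousAt.mpr fun y => (hasDerivAt_bracketInv y).continuousAt
    simp only [japaneseBracket_eq]
    exact (h0.inv₀ fun y => (bracketInv_pos y).ne').rpow_const fun y =>
      Or.inl (inv_pos.mpr (bracketInv_pos y)).ne'
  refine ⟨?_, ?_, ?_⟩
  · rw [show (2 : WithTop ℕ∞) = 1 + 1 from by norm_num, contDiff_succ_iff_deriv]
    exact ⟨fun y => (hA y).differentiableAt, by simp, by rwa [hderiv]⟩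
  · refine memLp_top_of_bound ((hjc _).mul hAc).aestronglyMeasurable 1 (ae_of_all _ fun y => ?_)
    have hk := bracketInv_pos y
    rw [Real.norm_eq_abs]
    refine abs_le_of_sq_le_sq ?_ zero_le_one
    rw [mul_pow, ← Real.rpow_natCast, ← Real.rpow_mul (by rw [japaneseBracket_eq]; positivity)]
    norm_num
    rw [japaneseBracket_eq, inv_mul_le_iff₀ hk, mul_one]
    have := sq_le_bracketInv_mul_profileSize y (A y) (D y)
    have := hS y
    nlinarith
  · rw [hderiv]
    refine memLp_top_of_bound ((hjc _).mul hDc.continuous).aestronglyMeasurable 1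
      (ae_of_all _ fun y => ?_)
    have hk := bracketInv_pos y
    rw [Real.norm_eq_abs]
    refine abs_le_of_sq_le_sq ?_ zero_le_one
    rw [mul_pow, ← Real.rpow_natCast, ← Real.rpow_mul (by rw [japaneseBracket_eq]; positivity)]
    norm_num
    rw [japaneseBracket_eq, Real.rpow_neg_one, inv_inv]
    exact (bracketInv_mul_sq_le_profileSize y (A y) (D y)).trans (hS y)

theorem IsProfileSolution.hasDerivAt {A₀ : ℝ} {A : ℝ → ℝ} (h : IsProfileSolution A₀ A) (y : ℝ) :
    HasDerivAt A (deriv A y) y :=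
  (h.mem.1.differentiable two_ne_zero y).hasDerivAt

theorem IsProfileSolution.hasDerivAt_deriv {A₀ : ℝ} {A : ℝ → ℝ} (h : IsProfileSolution A₀ A)
    (y : ℝ) : HasDerivAt (deriv A)
      (-(y ^ 2 / 16 * A y) + (y / 4 * A y ^ 3 - 3 / 16 * A y ^ 5)) y := by
  have h1 : ContDiff ℝ (1 + 1) A := by
    rw [one_add_one_eq_two]; exact h.mem.1
  have h2 := ((contDiff_succ_iff_deriv.mp h1).2.2.differentiable one_ne_zero y).hasDerivAt
  exact h2.congr_deriv (by linear_combination h.ode y)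

/-- Adjoining time as a component makes the equation autonomous with a `C¹` field, so no smallness
or growth condition is needed. -/
theorem eq_of_hasDerivAt_profile {A D B E : ℝ → ℝ} (hA : ∀ y, HasDerivAt A (D y) y)
    (hD : ∀ y, HasDerivAt D (-(y ^ 2 / 16 * A y) + (y / 4 * A y ^ 3 - 3 / 16 * A y ^ 5)) y)
    (hB : ∀ y, HasDerivAt B (E y) y)
    (hE : ∀ y, HasDerivAt E (-(y ^ 2 / 16 * B y) + (y / 4 * B y ^ 3 - 3 / 16 * B y ^ 5)) y)
    (h0 : A 0 = B 0) (h0' : D 0 = E 0) : A = B := by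
  have key := eq_of_forall_hasDerivAt contDiff_profileField (t₀ := 0)
    (γ := fun y => (y, A y, D y)) (γ' := fun y => (y, B y, E y))
    (fun y => hasDerivAt_profileField_iff.mpr ⟨hasDerivAt_id' y, hA y, hD y⟩)
    (fun y => hasDerivAt_profileField_iff.mpr ⟨hasDerivAt_id' y, hB y, hE y⟩)
    (by simp only [h0, h0'])
  funext y
  exact congrArg (fun p : ℝ × ℝ × ℝ => p.2.1) (congrFun key y)

theorem isProfileSolution_of_hasDerivAt {A D : ℝ → ℝ} (hA : ∀ y, HasDerivAt A (D y) y)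
    (hD : ∀ y, HasDerivAt D (-(y ^ 2 / 16 * A y) + (y / 4 * A y ^ 3 - 3 / 16 * A y ^ 5)) y)
    (hD0 : D 0 = 0) (hS : ∀ y, profileSize y (A y) (D y) ≤ 1) : IsProfileSolution (A 0) A := by
  have hderiv : deriv A = D := funext fun y => (hA y).deriv
  have hAc : Continuous A := continuous_iff_continuousAt.mpr fun y => (hA y).continuousAt
  have hDc : ContDiff ℝ 1 D := by
    refine contDiff_one_iff_deriv.mpr ⟨fun y => (hD y).differentiableAt, ?_⟩
    rw [funext fun y => (hD y).deriv]
    fun_prop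
  refine ⟨mem_profileSpace_of_profileSize_le hA hDc hS, fun y => ?_, rfl, by rw [hderiv, hD0]⟩
  rw [hderiv, (hD y).deriv]
  ring

theorem proposition1p4 :
    ∃ ε₀ : ℝ, 0 < ε₀ ∧ ∀ A₀ : ℝ, 0 < A₀ → A₀ < ε₀ →
      ∃ A : ℝ → ℝ, IsProfileSolution A₀ A ∧
        (∀ B : ℝ → ℝ, IsProfileSolution A₀ B → B = A) ∧
        (∃ Qp ωp : ℝ,
          (fun y : ℝ => A y - Qp * |y| ^ (-(1 / 2) : ℝ) *
            Real.cos (ωp - y ^ 2 / 8 + 3 / 16 * Qp ^ 2 * Real.log (y ^ 2 / 8)))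
            =O[atTop] (fun y : ℝ => y⁻¹)) ∧
        (∃ Qm ωm : ℝ,
          (fun y : ℝ => A y - Qm * |y| ^ (-(1 / 2) : ℝ) *
            Real.cos (ωm - y ^ 2 / 8 - 3 / 16 * Qm ^ 2 * Real.log (y ^ 2 / 8)))
            =O[atBot] (fun y : ℝ => y⁻¹)) := by
  refine ⟨profileThreshold, profileThreshold_pos, fun A₀ hpos hlt => ?_⟩
  obtain ⟨A, D, hA, hD, rfl, hD0, hS⟩ := exists_profile (by rwa [abs_of_pos hpos])
  refine ⟨A, isProfileSolution_of_hasDerivAt hA hD hD0 fun y => (hS y).trans (by norm_num),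
    fun B hB => ?_, ?_, ?_⟩
  · exact eq_of_hasDerivAt_profile hB.hasDerivAt hB.hasDerivAt_deriv hA hD hB.init
      (by rw [hB.init_deriv, hD0])
  · obtain ⟨Q, ω, h⟩ := exists_isBigO_atTop (σ := 1) (by simp) hA
      (fun y => by simpa only [one_mul] using hD y) hS
    exact ⟨Q, ω, by simpa only [one_mul] using h⟩
  -- The reflected function solves the equation with the odd coefficient `y/4` reversed, and its
  -- size is unchanged because the weight is even.
  · obtain ⟨Q, ω, h⟩ := exists_isBigO_atTop (A := fun y => A (-y)) (D := fun y => -D (-y))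
      (σ := -1) (by simp)
      (fun y => (HasDerivAt.comp y (hA (-y)) (hasDerivAt_neg y)).congr_deriv (by ring))
      (fun y => (HasDerivAt.comp y (hD (-y)) (hasDerivAt_neg y)).neg.congr_deriv (by ring))
      (fun y => by simpa only [profileSize, bracketInv_neg, neg_sq] using hS (-y))
    refine ⟨Q, ω, ?_⟩
    have h1 : ((fun y : ℝ => y⁻¹) ∘ Neg.neg) =O[atBot] fun y : ℝ => y⁻¹ :=
      IsBigO.of_bound 1 (Eventually.of_forall fun y => by simp)
    refine ((h.comp_tendsto tendsto_neg_atBot_atTop).trans h1).congr_left fun y => ?_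
    simp only [Function.comp_apply, neg_neg, abs_neg, neg_sq]
    congr 3
    ring
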